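/- Let $0<q<1$. Write $(a;q)_k=\prod_{j=0}^{k-1}(1-aq^j)$ and let the $q$-Racah polynomials be defined by $$R_n(q^{-x}+\gamma\delta q^{x+1};\alpha,\beta,\gamma,\delta\,|\,q) =\sum_{k=0}^{n}\frac{(q^{-n};q)_k\,(\alpha\beta q^{n+1};q)_k\,(q^{-x};q)_k\,(\gamma\delta q^{x+1};q)_k} {(\alpha q;q)_k\,(\beta\delta q;q)_k\,(\gamma q;q)_k\,(q;q)_k}\,q^k ,$$ which is a polynomial in $q^{-x}+\gamma\delta q^{x+1}$. Let $N\in\{\tfrac12,1,\tfrac32,\ldots\}$ and $\alpha,x\in\mathbb{C}$. (a) If $n\in\{0,1,\ldots,\lfloor N+\tfrac12\rfloor\}$ and $\alpha^2q^{2j}\ne1$ for $j=1,\ldots,2n$, then $$R_{2n}\big(q^{-x-N-\frac12}-q^{x-N-\frac12};\alpha,\alpha,q^{-2N-2},-1\,|\,q\big) =R_n\big(q^{-2x-2N-1}+q^{2x-2N-1};\alpha^2,q^{-1},q^{-2N-2},q^{-2N-2}\,|\,q^2\big).$$ (b) If $n\in\{0,1,\ldots,\lfloor N\rfloor\}$ and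 $\alpha^2q^{2j}\ne1$ for $j=1,\ldots,2n+1$, then $$R_{2n+1}\big(q^{-x-N-\frac12}-q^{x-N-\frac12};\alpha,\alpha,q^{-2N-2},-1\,|\,q\big) =\frac{q^{-x-N-\frac12}-q^{x-N-\frac12}}{1-q^{-2N-1}}\, R_n\big(q^{-2x-2N-1}+q^{2x-2N-1};\alpha^2,q,q^{-2N-2},q^{-2N-2}\,|\,q^2\big).$$ -/

import Mathlib

noncomputable section

/-- The `q`-shifted factorial `(a;q)_k = (1-a)(1-aq)⋯(1-aq^{k-1})`. -/
def qPoch (a q : ℂ) (k : ℕ) : ℂ := ∏ j ∈ Finset.range k, (1 - a * q ^ j)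

/-- The basic hypergeometric series `₄φ₃(a₁,a₂,a₃,a₄; b₁,b₂,b₃; q, z)`. -/
def phi43 (a₁ a₂ a₃ a₄ b₁ b₂ b₃ q z : ℂ) : ℂ :=
  ∑' k : ℕ, (qPoch a₁ q k * qPoch a₂ q k * qPoch a₃ q k * qPoch a₄ q k) /
    (qPoch b₁ q k * qPoch b₂ q k * qPoch b₃ q k * qPoch q q k) * z ^ k

/-- The `q`-Racah polynomial `R_n(y; α, β, γ, δ | q)` as a polynomial function of `y`.
Here `∏_{j<k} (1 - y q^j + γ δ q^{2j+1})` is `(q^{-x};q)_k (γ δ q^{x+1};q)_k` written as a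
polynomial in `y = q^{-x} + γ δ q^{x+1}`; the lemma `qRacah_eq_phi43` below is the usual
definition by a terminating `₄φ₃`. -/
def qRacah (n : ℕ) (y α β γ δ q : ℂ) : ℂ :=
  ∑ k ∈ Finset.range (n + 1),
    (qPoch ((q ^ n)⁻¹) q k * qPoch (α * β * q ^ (n + 1)) q k *
        ∏ j ∈ Finset.range k, (1 - y * q ^ j + γ * δ * q ^ (2 * j + 1))) /
      (qPoch (α * q) q k * qPoch (β * δ * q) q k * qPoch (γ * q) q k * qPoch q q k) * q ^ k

/-- With `u = q^x`:
`R_n(q^{-x} + γ δ q^{x+1}; α, β, γ, δ | q)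
  = ₄φ₃(q^{-n}, α β q^{n+1}, q^{-x}, γ δ q^{x+1}; α q, β δ q, γ q; q, q)`. -/
theorem qRacah_eq_phi43 (n : ℕ) (u α β γ δ q : ℂ) (hq : q ≠ 0) (hu : u ≠ 0) :
    qRacah n (u⁻¹ + γ * δ * (u * q)) α β γ δ q =
      phi43 ((q ^ n)⁻¹) (α * β * q ^ (n + 1)) u⁻¹ (γ * δ * (u * q))
        (α * q) (β * δ * q) (γ * q) q q := by
  unfold phi43 qRacah
  rw [tsum_eq_sum (s := Finset.range (n + 1))]
  · refine Finset.sum_congr rfl fun k _ => ?_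
    have h : ∏ j ∈ Finset.range k,
        (1 - (u⁻¹ + γ * δ * (u * q)) * q ^ j + γ * δ * q ^ (2 * j + 1)) =
        qPoch u⁻¹ q k * qPoch (γ * δ * (u * q)) q k := by
      unfold qPoch
      rw [← Finset.prod_mul_distrib]
      refine Finset.prod_congr rfl fun j _ => ?_
      field_simp
      ring
    rw [h]
    ring
  · intro k hk
    have hk' : n < k := by simpa using hk
    have h0 : qPoch ((q ^ n)⁻¹) q k = 0 := by
      unfold qPoch
      refine Finset.prod_eq_zero (Finset.mem_range.2 hk') ?_
      rw [inv_mul_cancel₀ (pow_ne_zero n hq), sub_self]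
    simp [h0]

end

noncomputable section

/-! ### Connection coefficients and their recurrences. -/

open Finset

/-! Put `c = q^{-2N-1}` and let `y` be the argument on the left. It is a difference of two powers
with product `c`, so the argument on the right is `y² + 2c`. Both sides are thus polynomials in `y`,
and they are compared in the basis `racahBasis`, written ψ_m.

The left side is a hypergeometric sum in ψ_m (`qRacah_eq_sum_basis`). The k-th term on the right is
a multiple of an even product in `y`, or of `y` times one; `even_expansion` and `odd_expansion`
write these in ψ_m with coefficients `quadCoeff` and `quadCoeffOdd`, which involve neither `c` nor
α. It remains to match the coefficient of each ψ_m, a single term on the left and a sum over `k` on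
the right. Both satisfy the same first-order recurrence in `m`: for the sum this is creative
telescoping in `k` (`sum_recurrence`), fed by the intertwining lemmas. They agree at `m = 0`, hence
for all `m` (`eq_of_recurrence`). -/

/-- Connection coefficient `(-q^{-k};q)_k (q^{-k};q)_j q^j / (q²;q²)_j`, indexed by `m = k + j`,
and zero for `m < k`. -/
def quadCoeff (q : ℂ) (k m : ℕ) : ℂ :=
  if k ≤ m then
    (∏ i ∈ range k, (1 + (q ^ (i + 1))⁻¹)) *
      ∏ i ∈ range (m - k), (q * (q ^ k - q ^ i) / (q ^ k * (1 - q ^ (2 * i + 2))))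
  else 0

/-- Connection coefficient for the odd family, see `odd_expansion`. -/
def quadCoeffOdd (q : ℂ) (k m : ℕ) : ℂ :=
  q * (1 - q ^ (m + 1)) * quadCoeff q (k + 1) (m + 1) / (1 - q ^ (2 * k + 2))

lemma quadCoeff_of_lt (q : ℂ) {k m : ℕ} (h : m < k) : quadCoeff q k m = 0 := by
  simp [quadCoeff, h]

lemma quadCoeff_add (q : ℂ) (k j : ℕ) : quadCoeff q k (k + j) =
    (∏ i ∈ range k, (1 + (q ^ (i + 1))⁻¹)) *
      ∏ i ∈ range j, (q * (q ^ k - q ^ i) / (q ^ k * (1 - q ^ (2 * i + 2)))) := by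
  simp [quadCoeff]

lemma quadCoeff_eq_zero (q : ℂ) {k m : ℕ} (h : 2 * k < m) : quadCoeff q k m = 0 := by
  obtain ⟨j, rfl⟩ : ∃ j, m = k + j := ⟨m - k, by omega⟩
  have h0 : ∏ i ∈ range j, (q * (q ^ k - q ^ i) / (q ^ k * (1 - q ^ (2 * i + 2)))) = 0 :=
    prod_eq_zero (i := k) (mem_range.2 (by omega)) (by simp)
  rw [quadCoeff_add, h0, mul_zero]

lemma quadCoeff_zero_zero (q : ℂ) : quadCoeff q 0 0 = 1 := by simp [quadCoeff]

lemma one_sub_ne_zero_of_pow {q : ℂ} (hq1 : ∀ j : ℕ, 1 ≤ j → q ^ j ≠ 1) (j : ℕ) (hj : 1 ≤ j) :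
    1 - q ^ j ≠ 0 := sub_ne_zero.2 (hq1 j hj).symm

/-- The term ratio in `m`, cleared of denominators so that it also holds off the support k ≤ m ≤ 2k.
With the diagonal step `quadCoeff_succ_succ` it yields the later contiguity identities as linear
combinations. -/
lemma quadCoeff_succ_right {q : ℂ} (hq : q ≠ 0) (hq1 : ∀ j : ℕ, 1 ≤ j → q ^ j ≠ 1) (k m : ℕ) :
    ((q ^ k) ^ 2 - q ^ 2 * (q ^ m) ^ 2) * quadCoeff q k (m + 1) =
      q * ((q ^ k) ^ 2 - q ^ m) * quadCoeff q k m := by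
  rcases lt_trichotomy (m + 1) k with h | h | h
  · rw [quadCoeff_of_lt q h, quadCoeff_of_lt q (by omega)]; ring
  · subst h
    -- On entering the support, at m + 1 = k, the left factor vanishes.
    rw [quadCoeff_of_lt q (Nat.lt_succ_self m)]; ring
  · obtain ⟨j, rfl⟩ : ∃ j, m = k + j := ⟨m - k, by omega⟩
    rw [add_assoc, quadCoeff_add, quadCoeff_add, prod_range_succ]
    have h1 := one_sub_ne_zero_of_pow hq1 (2 * j + 2) (by omega)
    have hk : q ^ k ≠ 0 := pow_ne_zero _ hq
    generalize (∏ i ∈ range j, (q * (q ^ k - q ^ i) / (q ^ k * (1 - q ^ (2 * i + 2))))) = S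
    generalize (∏ i ∈ range k, (1 + (q ^ (i + 1))⁻¹)) = T
    rw [pow_add q k j]
    have h2 : q ^ (2 * j + 2) = q ^ 2 * (q ^ j) ^ 2 := by ring
    rw [h2] at h1 ⊢
    generalize q ^ k = X at *
    generalize q ^ j = J at *
    field_simp

lemma quadCoeff_succ_succ {q : ℂ} (hq : q ≠ 0) (hq1 : ∀ j : ℕ, 1 ≤ j → q ^ j ≠ 1) (k m : ℕ) :
    (q ^ 2 * (q ^ k) ^ 2 - 1) * quadCoeff q k m =
      q * (q * (q ^ k) ^ 2 - q ^ m) * quadCoeff q (k + 1) (m + 1) := by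
  rcases lt_or_ge m k with h | h
  · rw [quadCoeff_of_lt q h, quadCoeff_of_lt q (by omega)]; ring
  obtain ⟨j, rfl⟩ : ∃ j, m = k + j := ⟨m - k, by omega⟩
  rw [show k + j + 1 = k + 1 + j by ring, quadCoeff_add, quadCoeff_add, prod_range_succ _ k]
  generalize (∏ i ∈ range k, (1 + (q ^ (i + 1))⁻¹)) = T
  have hk : q ^ k ≠ 0 := pow_ne_zero _ hq
  induction j with
  | zero =>
    simp only [range_zero, prod_empty, mul_one, add_zero, pow_succ q k]
    field_simp
    ring
  | succ j ih =>
    have h1 := one_sub_ne_zero_of_pow hq1 (2 * j + 2) (by omega)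
    rw [prod_range_succ, prod_range_succ]
    specialize ih (by omega)
    generalize (∏ i ∈ range j, (q * (q ^ k - q ^ i) / (q ^ k * (1 - q ^ (2 * i + 2))))) = S at *
    generalize (∏ i ∈ range j,
      (q * (q ^ (k + 1) - q ^ i) / (q ^ (k + 1) * (1 - q ^ (2 * i + 2))))) = S' at *
    generalize hU : 1 - q ^ (2 * j + 2) = U at *
    simp only [pow_add, pow_one] at ih ⊢
    generalize q ^ k = X at *
    generalize q ^ j = J at *
    have e : (q ^ 2 * X ^ 2 - 1) * (T * (S * (q * (X - J) / (X * U)))) =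
      ((q ^ 2 * X ^ 2 - 1) * (T * S)) * (q * (X - J) / (X * U)) := by ring
    rw [e, ih]
    field_simp

/-! ### Multiplication by `y`, linking even and odd expansions. -/

/-- Multiplication by `y` in a basis with `(1 - c q^m) ψ_{m+1} = (1 - c q^{2m} - y q^m) ψ_m`. -/
lemma mul_sum_basis {q c y : ℂ} (hq : q ≠ 0) (ψ a b : ℕ → ℂ) (M : ℕ)
    (hψ : ∀ m < M, (1 - c * q ^ m) * ψ (m + 1) = (1 - c * (q ^ m) ^ 2 - y * q ^ m) * ψ m)
    (h0 : b 0 = (1 - c) * a 0)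
    (hb : ∀ m, q * q ^ m * b (m + 1) =
      (1 - c * (q * q ^ m) ^ 2) * a (m + 1) - q * (1 - c * q ^ m) * a m)
    (ha : a M = 0) :
    y * ∑ m ∈ range M, a m * ψ m = ∑ m ∈ range (M + 1), b m * ψ m := by
  -- Truncating at `K` leaves one boundary term, proportional to `a K`; `ha` removes it at the top.
  have key : ∀ K ≤ M, y * ∑ m ∈ range K, a m * ψ m =
      ∑ m ∈ range (K + 1), b m * ψ m - (1 - c * (q ^ K) ^ 2) / q ^ K * a K * ψ K := by
    intro K hK
    induction K with
    | zero => simp [h0]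
    | succ K ih =>
      rw [sum_range_succ, mul_add, ih (by omega), sum_range_succ _ (K + 1)]
      have hk : q ^ K ≠ 0 := pow_ne_zero _ hq
      have h1 := hψ K (by omega)
      have h2 := hb K
      rw [pow_succ q K]
      generalize q ^ K = Z at *
      generalize (∑ m ∈ range (K + 1), b m * ψ m) = S
      field_simp
      linear_combination (a K * q) * h1 - ψ (K + 1) * h2
  rw [key M le_rfl, ha]
  ring

lemma quadCoeffOdd_mul {q : ℂ} (hq1 : ∀ j : ℕ, 1 ≤ j → q ^ j ≠ 1) (k m : ℕ) :
    (1 - q ^ 2 * (q ^ k) ^ 2) * quadCoeffOdd q k m =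
      q * (1 - q * q ^ m) * quadCoeff q (k + 1) (m + 1) := by
  have h1 := one_sub_ne_zero_of_pow hq1 (2 * k + 2) (by omega)
  unfold quadCoeffOdd
  have h2 : q ^ (2 * k + 2) = q ^ 2 * (q ^ k) ^ 2 := by ring
  rw [h2] at h1 ⊢
  field_simp
  ring

lemma one_sub_sq_ne_zero {q : ℂ} (hq1 : ∀ j : ℕ, 1 ≤ j → q ^ j ≠ 1) (k : ℕ) :
    1 - q ^ 2 * (q ^ k) ^ 2 ≠ 0 := by
  have h1 := one_sub_ne_zero_of_pow hq1 (2 * k + 2) (by omega)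
  rwa [show q ^ (2 * k + 2) = q ^ 2 * (q ^ k) ^ 2 by ring] at h1

/-- Half of the induction step: on the product side, with E_k and O_k the normalised even and odd
products, it reads y E_k = (1 - c q^{2k}) O_k. -/
lemma odd_of_even_expansion {q c y : ℂ} (hq : q ≠ 0) (hq1 : ∀ j : ℕ, 1 ≤ j → q ^ j ≠ 1)
    (ψ : ℕ → ℂ) (k : ℕ)
    (hψ : ∀ m < 2 * k + 1,
      (1 - c * q ^ m) * ψ (m + 1) = (1 - c * (q ^ m) ^ 2 - y * q ^ m) * ψ m) :
    y * ∑ m ∈ range (2 * k + 1), quadCoeff q k m * ψ m =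
      (1 - c * (q ^ k) ^ 2) * ∑ m ∈ range (2 * k + 2), quadCoeffOdd q k m * ψ m := by
  have hX := one_sub_sq_ne_zero hq1 k
  rw [mul_sum_basis hq ψ _ (fun m => (1 - c * (q ^ k) ^ 2) * quadCoeffOdd q k m) _ hψ,
    mul_sum]
  · exact sum_congr rfl fun _ _ => by ring
  · rcases k with _ | k
    · have h := quadCoeffOdd_mul hq1 0 0
      have h2 := quadCoeff_succ_succ hq hq1 0 0
      simp only [pow_zero] at h h2 hX ⊢
      apply mul_left_cancel₀ hX
      linear_combination (1 - c) * (h + h2)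
    · simp [quadCoeffOdd, quadCoeff_of_lt]
  · intro m
    have h := quadCoeffOdd_mul hq1 k (m + 1)
    have h2 := quadCoeff_succ_succ hq hq1 k m
    have h3 := quadCoeff_succ_succ hq hq1 k (m + 1)
    have h4 := quadCoeff_succ_right hq hq1 (k + 1) (m + 1)
    simp only [pow_succ q k, pow_succ q m] at *
    apply mul_left_cancel₀ hX
    generalize q ^ k = X at *
    generalize q ^ m = Z at *
    linear_combination q * Z * (1 - c * X ^ 2) * h + (1 - c * q ^ 2 * Z ^ 2) * h3
      - q * (1 - c * Z) * h2 + (1 - c * Z) * h4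
  · exact quadCoeff_eq_zero q (by omega)

/-- The other half: E_{k+1} arises from E_k and y O_k because its new factor is (1 - c q^{2k})² - y²
q^{2k}. -/
lemma even_of_odd_expansion {q c y : ℂ} (hq : q ≠ 0) (hq1 : ∀ j : ℕ, 1 ≤ j → q ^ j ≠ 1)
    (ψ : ℕ → ℂ) (k : ℕ)
    (hψ : ∀ m < 2 * k + 2,
      (1 - c * q ^ m) * ψ (m + 1) = (1 - c * (q ^ m) ^ 2 - y * q ^ m) * ψ m) :
    (1 - c * (q ^ k) ^ 2) * (∑ m ∈ range (2 * k + 1), quadCoeff q k m * ψ m) -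
      (q ^ k) ^ 2 * (y * ∑ m ∈ range (2 * k + 2), quadCoeffOdd q k m * ψ m) =
      (1 - c * q * (q ^ k) ^ 2) * ∑ m ∈ range (2 * k + 3), quadCoeff q (k + 1) m * ψ m := by
  have hX := one_sub_sq_ne_zero hq1 k
  have hk : q ^ k ≠ 0 := pow_ne_zero _ hq
  have e : ∑ m ∈ range (2 * k + 1), quadCoeff q k m * ψ m =
      ∑ m ∈ range (2 * k + 3), quadCoeff q k m * ψ m := by
    rw [sum_range_succ _ (2 * k + 2), sum_range_succ _ (2 * k + 1),
      quadCoeff_eq_zero q (show 2 * k < 2 * k + 1 by omega),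
      quadCoeff_eq_zero q (show 2 * k < 2 * k + 2 by omega)]
    ring
  -- The coefficients of `y` times the odd sum are found by solving the claimed identity for them.
  rw [mul_sum_basis hq ψ _ (fun m => ((1 - c * (q ^ k) ^ 2) * quadCoeff q k m -
    (1 - c * q * (q ^ k) ^ 2) * quadCoeff q (k + 1) m) / (q ^ k) ^ 2) _ hψ, e]
  · simp only [mul_sum, ← sum_sub_distrib]
    refine sum_congr rfl fun m _ => ?_
    field_simp
    ring
  · have h := quadCoeffOdd_mul hq1 k 0
    have h2 := quadCoeff_succ_succ hq hq1 k 0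
    have h3 := quadCoeff_succ_right hq hq1 (k + 1) 0
    have h5 : quadCoeff q (k + 1) 0 = 0 := quadCoeff_of_lt q (by omega)
    rw [h5] at h3 ⊢
    simp only [pow_succ q k, pow_zero] at *
    rw [div_eq_iff (pow_ne_zero 2 hk)]
    apply mul_left_cancel₀ hX
    apply mul_left_cancel₀ hq
    generalize q ^ k = X at *
    linear_combination -q * (1 - c * X ^ 2) * h2 - q * X ^ 2 * (1 - c) * h +
      (c * q * X ^ 2 - 1) * h3
  · intro m
    have h := quadCoeffOdd_mul hq1 k (m + 1)
    have h' := quadCoeffOdd_mul hq1 k m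
    have h3 := quadCoeff_succ_succ hq hq1 k (m + 1)
    have h4 := quadCoeff_succ_right hq hq1 (k + 1) (m + 1)
    simp only [pow_succ q k, pow_succ q m] at *
    rw [mul_div_assoc', div_eq_iff (pow_ne_zero 2 hk)]
    apply mul_left_cancel₀ hX
    apply mul_left_cancel₀ hq
    generalize q ^ k = X at *
    generalize q ^ m = Z at *
    linear_combination -q ^ 2 * Z * (1 - c * X ^ 2) * h3
      - q * X ^ 2 * (1 - c * q ^ 2 * Z ^ 2) * h + q ^ 2 * X ^ 2 * (1 - c * Z) * h'
      + (c * q ^ 2 * Z * X ^ 2 - 1) * h4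
  · simp only [quadCoeffOdd]
    rw [quadCoeff_eq_zero q (by omega)]
    ring

/-! ### Shifted factorials and the expansions of the even and odd products. -/

lemma qPoch_zero (a q : ℂ) : qPoch a q 0 = 1 := by simp [qPoch]

lemma qPoch_succ (a q : ℂ) (k : ℕ) : qPoch a q (k + 1) = qPoch a q k * (1 - a * q ^ k) := by
  simp [qPoch, prod_range_succ]

lemma qPoch_ne_zero {a q : ℂ} {k : ℕ} (h : ∀ j < k, 1 - a * q ^ j ≠ 0) : qPoch a q k ≠ 0 :=
  prod_ne_zero_iff.2 fun j hj => h j (mem_range.1 hj)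

lemma qPoch_two_mul (a q : ℂ) (k : ℕ) :
    qPoch a q (2 * k) = qPoch a (q ^ 2) k * qPoch (a * q) (q ^ 2) k := by
  induction k with
  | zero => simp [qPoch_zero]
  | succ k ih =>
    rw [show 2 * (k + 1) = 2 * k + 1 + 1 by ring, qPoch_succ, qPoch_succ, ih, qPoch_succ,
      qPoch_succ]
    ring

lemma qPoch_mul_qPoch_neg (a q : ℂ) (k : ℕ) :
    qPoch a q k * qPoch (-a) q k = qPoch (a ^ 2) (q ^ 2) k := by
  unfold qPoch
  rw [← prod_mul_distrib]
  exact prod_congr rfl fun j _ => by ring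

lemma qPoch_succ_left (a q : ℂ) (k : ℕ) :
    qPoch a q (k + 1) = (1 - a) * qPoch (a * q) q k := by
  unfold qPoch
  rw [prod_range_succ', mul_comm]
  congr 1
  · simp
  · exact prod_congr rfl fun j _ => by ring

lemma even_expansion {q c y : ℂ} (hq : q ≠ 0) (hq1 : ∀ j : ℕ, 1 ≤ j → q ^ j ≠ 1)
    (ψ : ℕ → ℂ) (h0 : ψ 0 = 1) (k : ℕ)
    (hc : ∀ m < 2 * k, 1 - c * q ^ m ≠ 0)
    (hψ : ∀ m < 2 * k,
      (1 - c * q ^ m) * ψ (m + 1) = (1 - c * (q ^ m) ^ 2 - y * q ^ m) * ψ m) :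
    (∏ j ∈ range k, ((1 - c * (q ^ j) ^ 2) ^ 2 - y ^ 2 * (q ^ j) ^ 2)) / qPoch c q (2 * k) =
      ∑ m ∈ range (2 * k + 1), quadCoeff q k m * ψ m := by
  induction k with
  | zero => simp [h0, quadCoeff_zero_zero, qPoch_zero]
  | succ k ih =>
    have ih := ih (fun m hm => hc m (by omega)) (fun m hm => hψ m (by omega))
    have h1 := odd_of_even_expansion hq hq1 ψ k (fun m hm => hψ m (by omega))
    have h2 := even_of_odd_expansion hq hq1 ψ k (fun m hm => hψ m (by omega))
    have c1 := hc (2 * k) (by omega)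
    have c2 := hc (2 * k + 1) (by omega)
    have hp : qPoch c q (2 * k) ≠ 0 := qPoch_ne_zero fun j hj => hc j (by omega)
    rw [show 2 * (k + 1) = 2 * k + 1 + 1 by ring, qPoch_succ, qPoch_succ, prod_range_succ]
    rw [show 2 * k + 1 + 1 + 1 = 2 * k + 3 by ring]
    rw [show q ^ (2 * k + 1) = q * (q ^ k) ^ 2 by ring] at *
    rw [show q ^ (2 * k) = (q ^ k) ^ 2 by ring] at *
    rw [← ih] at h1 h2
    generalize (∑ m ∈ range (2 * k + 2), quadCoeffOdd q k m * ψ m) = O at *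
    generalize (∑ m ∈ range (2 * k + 3), quadCoeff q (k + 1) m * ψ m) = S at *
    generalize (∏ j ∈ range k, ((1 - c * (q ^ j) ^ 2) ^ 2 - y ^ 2 * (q ^ j) ^ 2)) = F at *
    generalize qPoch c q (2 * k) = G at *
    generalize q ^ k = X at *
    apply mul_left_cancel₀ c1
    apply mul_left_cancel₀ c2
    have e : (1 - c * (q * X ^ 2)) * ((1 - c * X ^ 2) *
        (F * ((1 - c * X ^ 2) ^ 2 - y ^ 2 * X ^ 2) /
          (G * (1 - c * X ^ 2) * (1 - c * (q * X ^ 2))))) =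
        (F / G) * ((1 - c * X ^ 2) ^ 2 - y ^ 2 * X ^ 2) := by
      generalize 1 - c * (q * X ^ 2) = V at *
      generalize 1 - c * X ^ 2 = U at *
      field_simp
    rw [e]
    linear_combination (1 - c * X ^ 2) * h2 - y * X ^ 2 * h1

lemma odd_expansion {q c y : ℂ} (hq : q ≠ 0) (hq1 : ∀ j : ℕ, 1 ≤ j → q ^ j ≠ 1)
    (ψ : ℕ → ℂ) (h0 : ψ 0 = 1) (k : ℕ)
    (hc : ∀ m < 2 * k + 1, 1 - c * q ^ m ≠ 0)
    (hψ : ∀ m < 2 * k + 1,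
      (1 - c * q ^ m) * ψ (m + 1) = (1 - c * (q ^ m) ^ 2 - y * q ^ m) * ψ m) :
    y * (∏ j ∈ range k, ((1 - c * (q ^ j) ^ 2) ^ 2 - y ^ 2 * (q ^ j) ^ 2)) /
        qPoch c q (2 * k + 1) =
      ∑ m ∈ range (2 * k + 2), quadCoeffOdd q k m * ψ m := by
  have h1 := odd_of_even_expansion hq hq1 ψ k hψ
  rw [← even_expansion hq hq1 ψ h0 k (fun m hm => hc m (by omega))
    (fun m hm => hψ m (by omega))] at h1
  have c1 := hc (2 * k) (by omega)
  have e : q ^ (2 * k) = (q ^ k) ^ 2 := by ring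
  rw [qPoch_succ, ← div_div, div_eq_iff c1, mul_div_assoc, h1, e]
  ring

/-! ### Telescoping in `k` and the intertwining relations. -/

/-- Summing the intertwining relation `hW` of the connection coefficients `W` against a
hypergeometric sequence `b`. -/
lemma sum_recurrence {q e A B D : ℂ} (hq : q ≠ 0) (he : e ≠ 0)
    (W : ℕ → ℕ → ℂ) (b : ℕ → ℂ) (m n : ℕ)
    (h0 : e * (1 - q * q ^ m) * (1 - D * (q ^ m) ^ 2) * W 0 (m + 1) +
      q * (q ^ m * (1 + A * B * e ^ 2) - e * (1 + A * B * (q ^ m) ^ 2)) * W 0 m = 0)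
    (hW : ∀ k, e * q * (q ^ k) ^ 2 * (1 - q * q ^ m) * (1 - D * (q ^ m) ^ 2) * W (k + 1) (m + 1) +
      (q ^ m * (1 + A * B * e ^ 2 * q ^ 4 * (q ^ k) ^ 4) -
        e * q ^ 2 * (q ^ k) ^ 2 * (1 + A * B * (q ^ m) ^ 2)) * W (k + 1) m =
      q ^ m * (1 - D * (q ^ k) ^ 2) * (1 - q ^ 2 * (q ^ k) ^ 2) * W k m)
    (hb : ∀ k < n, (1 - D * (q ^ k) ^ 2) * (1 - q ^ 2 * (q ^ k) ^ 2) * b (k + 1) =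
      q ^ 2 * (1 - A * (e * (q ^ k) ^ 2)) * (1 - B * (e * (q ^ k) ^ 2)) * b k)
    (hA : 1 - A * (e * (q ^ n) ^ 2) = 0) :
    (1 - q * q ^ m) * (1 - D * (q ^ m) ^ 2) * ∑ k ∈ range (n + 1), b k * W k (m + 1) =
      q * (1 - A * q ^ m) * (1 - B * q ^ m) * ∑ k ∈ range (n + 1), b k * W k m := by
  -- Telescoping certificate: the defect of the recurrence for the sum cut at `K` is one explicit
  -- term, and its factor in `A` vanishes at K = n by `hA`.
  have key : ∀ K ≤ n, e * (q ^ K) ^ 2 * ((1 - q * q ^ m) * (1 - D * (q ^ m) ^ 2) *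
      (∑ k ∈ range (K + 1), b k * W k (m + 1)) -
      q * (1 - A * q ^ m) * (1 - B * q ^ m) * ∑ k ∈ range (K + 1), b k * W k m) =
      -(q * q ^ m * (1 - A * (e * (q ^ K) ^ 2)) * (1 - B * (e * (q ^ K) ^ 2)) * b K * W K m) := by
    intro K hK
    induction K with
    | zero =>
      simp only [zero_add, range_one, sum_singleton, pow_zero]
      linear_combination b 0 * h0
    | succ K ih =>
      have ih := ih (by omega)
      have h1 := hW K
      have h2 := hb K (by omega)
      rw [sum_range_succ _ (K + 1), sum_range_succ _ (K + 1), pow_succ q K]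
      generalize (∑ k ∈ range (K + 1), b k * W k (m + 1)) = S at *
      generalize (∑ k ∈ range (K + 1), b k * W k m) = T at *
      generalize q ^ K = X at *
      generalize q ^ m = Z at *
      linear_combination q ^ 2 * ih + q * b (K + 1) * h1 + q * Z * W K m * h2
  have h := key n le_rfl
  have hn : e * (q ^ n) ^ 2 ≠ 0 := mul_ne_zero he (pow_ne_zero _ (pow_ne_zero _ hq))
  rw [hA] at h
  refine sub_eq_zero.1 ((mul_eq_zero.1 (h.trans ?_)).resolve_left hn)
  ring

lemma quadCoeff_zero_left (q : ℂ) {m : ℕ} (h : m ≠ 0) : quadCoeff q 0 m = 0 :=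
  quadCoeff_eq_zero q (by omega)

lemma quadCoeff_intertwine {q P D : ℂ} (hq : q ≠ 0) (hq1 : ∀ j : ℕ, 1 ≤ j → q ^ j ≠ 1)
    (hD : D = P * q) (k m : ℕ) :
    q * (q ^ k) ^ 2 * (1 - q * q ^ m) * (1 - D * (q ^ m) ^ 2) * quadCoeff q (k + 1) (m + 1) +
      (q ^ m * (1 + P * q ^ 4 * (q ^ k) ^ 4) -
        q ^ 2 * (q ^ k) ^ 2 * (1 + P * (q ^ m) ^ 2)) * quadCoeff q (k + 1) m =
      q ^ m * (1 - D * (q ^ k) ^ 2) * (1 - q ^ 2 * (q ^ k) ^ 2) * quadCoeff q k m := by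
  have h2 := quadCoeff_succ_succ hq hq1 k m
  have h4 := quadCoeff_succ_right hq hq1 (k + 1) m
  rw [pow_succ q k] at h4
  apply mul_left_cancel₀ hq
  generalize q ^ k = X at *
  generalize q ^ m = Z at *
  subst hD
  linear_combination (1 - P * q ^ 2 * X ^ 2 * Z) * h4 + q * Z * (1 - P * q * X ^ 2) * h2

lemma quadCoeffOdd_intertwine {q P D : ℂ} (hq : q ≠ 0) (hq1 : ∀ j : ℕ, 1 ≤ j → q ^ j ≠ 1)
    (hD : D = P * q) (k m : ℕ) :
    q * q * (q ^ k) ^ 2 * (1 - q * q ^ m) * (1 - D * (q ^ m) ^ 2) *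
        quadCoeffOdd q (k + 1) (m + 1) +
      (q ^ m * (1 + P * q ^ 2 * q ^ 4 * (q ^ k) ^ 4) -
        q * q ^ 2 * (q ^ k) ^ 2 * (1 + P * (q ^ m) ^ 2)) * quadCoeffOdd q (k + 1) m =
      q ^ m * (1 - D * (q ^ k) ^ 2) * (1 - q ^ 2 * (q ^ k) ^ 2) * quadCoeffOdd q k m := by
  have hX := one_sub_sq_ne_zero hq1 (k + 1)
  have hA := quadCoeffOdd_mul hq1 (k + 1) (m + 1)
  have hB := quadCoeffOdd_mul hq1 (k + 1) m
  have hC := quadCoeffOdd_mul hq1 k m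
  have h3 := quadCoeff_succ_succ hq hq1 (k + 1) (m + 1)
  have h4 := quadCoeff_succ_right hq hq1 (k + 1 + 1) (m + 1)
  simp only [pow_succ q (k + 1), pow_succ q k, pow_succ q m] at *
  apply mul_left_cancel₀ hX
  apply mul_left_cancel₀ hq
  generalize q ^ k = X at *
  generalize q ^ m = Z at *
  subst hD
  linear_combination q ^ 3 * X ^ 2 * (1 - q * Z) * (1 - P * q * Z ^ 2) * hA +
    q * (Z - q ^ 3 * X ^ 2) * (1 - P * q ^ 3 * X ^ 2 * Z) * hB -
    q * Z * (1 - P * q * X ^ 2) * (1 - q ^ 4 * X ^ 2) * hC +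
    q ^ 2 * Z * (1 - P * q * X ^ 2) * (1 - q * Z) * h3 +
    (1 - P * q ^ 3 * X ^ 2 * Z) * (1 - q * Z) * h4

/-- The start of the telescoping, where no term with smaller `k` exists. Only m = 0 and m = 1
matter, as `quadCoeffOdd q 0` is supported there. -/
lemma quadCoeffOdd_intertwine_zero {q P D : ℂ} (hq : q ≠ 0) (hq1 : ∀ j : ℕ, 1 ≤ j → q ^ j ≠ 1)
    (hD : D = P * q) (m : ℕ) :
    q * (1 - q * q ^ m) * (1 - D * (q ^ m) ^ 2) * quadCoeffOdd q 0 (m + 1) +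
      q * (q ^ m * (1 + P * q ^ 2) - q * (1 + P * (q ^ m) ^ 2)) * quadCoeffOdd q 0 m = 0 := by
  have hX := one_sub_sq_ne_zero hq1 0
  have hA := quadCoeffOdd_mul hq1 0 (m + 1)
  have hB := quadCoeffOdd_mul hq1 0 m
  have h4 := quadCoeff_succ_right hq hq1 (0 + 1) (m + 1)
  subst hD
  rcases m with _ | m
  · simp only [zero_add, pow_zero, pow_one, mul_one, one_pow] at *
    apply (mul_eq_zero.1 _).resolve_left hX
    apply mul_left_cancel₀ hq
    linear_combination q ^ 2 * (1 - q) * (1 - P * q) * hA + q ^ 2 * (1 - q) * (1 - P * q) * hB +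
      (1 - P * q) * q * (1 - q) * h4
  · rw [quadCoeff_eq_zero q (show 2 * (0 + 1) < m + 1 + 1 + 1 by omega)] at h4 hA
    simp only [zero_add, pow_zero, pow_one, mul_one, one_pow, pow_succ q (m + 1), pow_succ q m] at *
    apply (mul_eq_zero.1 _).resolve_left hX
    apply mul_left_cancel₀ hq
    generalize q ^ m = Z at *
    linear_combination q ^ 2 * (1 - q * (Z * q)) * (1 - P * q * (Z * q) ^ 2) * hA -
      q ^ 3 * (1 - Z) * (1 - q ^ 2 * P * Z) * hB +
      q * (1 - q ^ 2 * P * Z) * (1 - q ^ 2 * Z) * h4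

/-! ### Hypergeometric coefficients and the basis in `y`. -/

/-- The `k`-th coefficient `(A;p)_k (B;p)_k p^k / ((D;s)_k (p;p)_k)`. -/
def hypCoeff (A B D p s : ℂ) (k : ℕ) : ℂ :=
  qPoch A p k * qPoch B p k / (qPoch D s k * qPoch p p k) * p ^ k

lemma hypCoeff_zero (A B D p s : ℂ) : hypCoeff A B D p s 0 = 1 := by
  simp [hypCoeff, qPoch_zero]

lemma hypCoeff_succ {A B D p s : ℂ} {k : ℕ} (h1 : 1 - D * s ^ k ≠ 0) (h2 : 1 - p * p ^ k ≠ 0) :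
    (1 - D * s ^ k) * (1 - p * p ^ k) * hypCoeff A B D p s (k + 1) =
      p * (1 - A * p ^ k) * (1 - B * p ^ k) * hypCoeff A B D p s k := by
  simp only [hypCoeff, qPoch_succ, pow_succ p k]
  generalize qPoch D s k = U
  generalize qPoch p p k = V
  generalize qPoch A p k = F
  generalize qPoch B p k = G
  generalize p ^ k = X at *
  generalize s ^ k = Y at *
  have : (U * (1 - D * Y) * (V * (1 - p * X))) = ((1 - D * Y) * (1 - p * X)) * (U * V) := by ring
  rw [this, ← div_div]
  field_simp

lemma eq_of_recurrence {a d f g : ℕ → ℂ} (M : ℕ) (h0 : a 0 = d 0) (hf : ∀ m < M, f m ≠ 0)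
    (ha : ∀ m < M, f m * a (m + 1) = g m * a m) (hd : ∀ m < M, f m * d (m + 1) = g m * d m) :
    ∀ m ≤ M, a m = d m := by
  intro m hm
  induction m with
  | zero => exact h0
  | succ m ih =>
    apply mul_left_cancel₀ (hf m hm)
    rw [ha m hm, hd m hm, ih (by omega)]

/-- The basis `∏_{j<m} (1 - c q^{2j} - y q^j) / (c;q)_m`. -/
def racahBasis (q c y : ℂ) (m : ℕ) : ℂ :=
  (∏ j ∈ range m, (1 - c * (q ^ j) ^ 2 - y * q ^ j)) / qPoch c q m

lemma racahBasis_zero (q c y : ℂ) : racahBasis q c y 0 = 1 := by simp [racahBasis, qPoch_zero]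

lemma racahBasis_succ {q c y : ℂ} {m : ℕ} (h : 1 - c * q ^ m ≠ 0) :
    (1 - c * q ^ m) * racahBasis q c y (m + 1) =
      (1 - c * (q ^ m) ^ 2 - y * q ^ m) * racahBasis q c y m := by
  simp only [racahBasis, prod_range_succ, qPoch_succ]
  rw [← div_div]
  generalize (∏ j ∈ range m, (1 - c * (q ^ j) ^ 2 - y * q ^ j)) = F
  generalize 1 - c * q ^ m = U at *
  field_simp

/-- With β = α and δ = -1 the denominators (αq;q)_k and (-αq;q)_k merge into (α²q²;q²)_k, hence the
separate base `s` in `hypCoeff`. -/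
lemma qRacah_eq_sum_basis {q : ℂ} (hq : q ≠ 0) (r : ℕ) (y α c : ℂ) :
    qRacah r y α α (c / q) (-1) q = ∑ m ∈ range (r + 1),
      hypCoeff ((q ^ r)⁻¹) (α * α * q ^ (r + 1)) (α ^ 2 * q ^ 2) q (q ^ 2) m *
        racahBasis q c y m := by
  unfold qRacah hypCoeff racahBasis
  refine sum_congr rfl fun k _ => ?_
  have e1 : ∏ j ∈ range k, (1 - y * q ^ j + c / q * -1 * q ^ (2 * j + 1)) =
      ∏ j ∈ range k, (1 - c * (q ^ j) ^ 2 - y * q ^ j) := by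
    refine prod_congr rfl fun j _ => ?_
    field_simp
    ring
  have e2 : qPoch (α * q) q k * qPoch (α * -1 * q) q k = qPoch (α ^ 2 * q ^ 2) (q ^ 2) k := by
    rw [← mul_pow, ← qPoch_mul_qPoch_neg]
    ring_nf
  rw [e1, e2, div_mul_cancel₀ c hq]
  simp only [div_eq_mul_inv, mul_inv]
  ring

/-! ### The quadratic transformations for general `c`. -/

lemma even_product (q c y : ℂ) (hq : q ≠ 0) (k : ℕ) :
    ∏ j ∈ range k, (1 - (y ^ 2 + 2 * c) * (q ^ 2) ^ j +
        c / q * (c / q) * (q ^ 2) ^ (2 * j + 1)) =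
      ∏ j ∈ range k, ((1 - c * (q ^ j) ^ 2) ^ 2 - y ^ 2 * (q ^ j) ^ 2) := by
  refine prod_congr rfl fun j _ => ?_
  field_simp
  ring

theorem qRacah_even {q : ℂ} (hq : q ≠ 0) (hq1 : ∀ j : ℕ, 1 ≤ j → q ^ j ≠ 1) (n : ℕ) (y α c : ℂ)
    (hc : ∀ m < 2 * n, 1 - c * q ^ m ≠ 0)
    (hα : ∀ j : ℕ, 1 ≤ j → j ≤ 2 * n → α ^ 2 * q ^ (2 * j) ≠ 1) :
    qRacah (2 * n) y α α (c / q) (-1) q =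
      qRacah n (y ^ 2 + 2 * c) (α ^ 2) q⁻¹ (c / q) (c / q) (q ^ 2) := by
  set A := (q ^ (2 * n))⁻¹ with hA
  set B := α * α * q ^ (2 * n + 1) with hB
  set D := α ^ 2 * q ^ 2 with hD
  have hqn : q ^ n ≠ 0 := pow_ne_zero _ hq
  have hAB : D = A * B * q := by
    rw [hA, hB, hD]
    field_simp
    ring
  have hD1 : ∀ m < 2 * n, 1 - D * (q ^ 2) ^ m ≠ 0 := fun m hm =>
    sub_ne_zero.2 fun h => hα (m + 1) (by omega) (by omega) (by rw [h, hD]; ring)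
  have hq2 : ∀ m : ℕ, 1 - q * q ^ m ≠ 0 := fun m => by
    rw [← pow_succ']; exact one_sub_ne_zero_of_pow hq1 _ (by omega)
  have hq3 : ∀ m : ℕ, 1 - q ^ 2 * (q ^ 2) ^ m ≠ 0 := fun m => by
    rw [← pow_succ', ← pow_mul]; exact one_sub_ne_zero_of_pow hq1 _ (by omega)
  have hsq : ∀ m : ℕ, (q ^ 2) ^ m = (q ^ m) ^ 2 := fun m => by ring
  set ψ := racahBasis q c y with hψ
  have hrhs : qRacah n (y ^ 2 + 2 * c) (α ^ 2) q⁻¹ (c / q) (c / q) (q ^ 2) =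
      ∑ k ∈ range (n + 1), hypCoeff A B D (q ^ 2) (q ^ 2) k *
        ∑ m ∈ range (2 * n + 1), quadCoeff q k m * ψ m := by
    unfold qRacah hypCoeff
    refine sum_congr rfl fun k hk => ?_
    have hk' : k ≤ n := by simpa [Nat.lt_succ_iff] using hk
    have e : ∑ m ∈ range (2 * n + 1), quadCoeff q k m * ψ m =
        ∑ m ∈ range (2 * k + 1), quadCoeff q k m * ψ m := by
      symm
      apply sum_subset (range_subset_range.2 (by omega))
      intro m _ hm
      rw [quadCoeff_eq_zero q (by simpa using hm), zero_mul]
    rw [e, ← even_expansion hq hq1 ψ (racahBasis_zero q c y) k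
      (fun m hm => hc m (by omega)) (fun m hm => racahBasis_succ (hc m (by omega))),
      even_product q c y hq, qPoch_two_mul]
    have e1 : ((q ^ 2) ^ n)⁻¹ = A := by rw [hA, pow_mul]
    have e2 : α ^ 2 * q⁻¹ * (q ^ 2) ^ (n + 1) = B := by
      rw [hB]; field_simp; ring
    have e3 : q⁻¹ * (c / q) * q ^ 2 = c := by field_simp
    have e4 : c / q * q ^ 2 = c * q := by field_simp
    rw [e1, e2, e3, e4]
    simp only [div_eq_mul_inv, mul_inv]
    ring
  rw [hrhs, qRacah_eq_sum_basis hq]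
  simp only [mul_sum]
  rw [sum_comm]
  simp only [← mul_assoc]
  simp only [← sum_mul]
  refine sum_congr rfl fun m hm => ?_
  congr 1
  have hm' : m ≤ 2 * n := by simpa [Nat.lt_succ_iff] using hm
  refine eq_of_recurrence (f := fun m => (1 - q * q ^ m) * (1 - D * (q ^ m) ^ 2))
    (g := fun m => q * (1 - A * q ^ m) * (1 - B * q ^ m))
    (d := fun m => ∑ k ∈ range (n + 1), hypCoeff A B D (q ^ 2) (q ^ 2) k * quadCoeff q k m)
    (2 * n) ?_ ?_ ?_ ?_ m hm'
  · rw [sum_eq_single 0]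
    · simp [hypCoeff_zero, quadCoeff_zero_zero]
    · intro k _ hk
      rw [quadCoeff_of_lt q (Nat.pos_of_ne_zero hk), mul_zero]
    · simp
  · intro m hm
    rw [← hsq]
    exact mul_ne_zero (hq2 m) (hD1 m hm)
  · intro m hm
    have h := hypCoeff_succ (A := A) (B := B) (hD1 m hm) (hq2 m)
    simp only [hsq] at h ⊢
    linear_combination h
  · intro m hm
    -- On the right the numerator parameters in base q² are `A`, `B` themselves, so the shift `e` is
    -- 1; in the odd case they are `A * q`, `B * q` and `e` is `q`.
    refine sum_recurrence (e := 1) hq one_ne_zero (quadCoeff q) _ m n ?_ ?_ ?_ ?_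
    · rcases m with _ | m
      · rw [quadCoeff_zero_left q (by omega)]
        ring
      · rw [quadCoeff_zero_left q (by omega), quadCoeff_zero_left q (by omega)]
        ring
    · intro k
      linear_combination quadCoeff_intertwine hq hq1 hAB k m
    · intro k hk
      have h := hypCoeff_succ (A := A) (B := B) (hD1 k (by omega)) (hq3 k)
      simp only [hsq] at h ⊢
      linear_combination h
    · rw [hA]
      field_simp
      ring

theorem qRacah_odd {q : ℂ} (hq : q ≠ 0) (hq1 : ∀ j : ℕ, 1 ≤ j → q ^ j ≠ 1) (n : ℕ) (y α c : ℂ)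
    (hc : ∀ m < 2 * n + 1, 1 - c * q ^ m ≠ 0)
    (hα : ∀ j : ℕ, 1 ≤ j → j ≤ 2 * n + 1 → α ^ 2 * q ^ (2 * j) ≠ 1) :
    qRacah (2 * n + 1) y α α (c / q) (-1) q =
      y / (1 - c) * qRacah n (y ^ 2 + 2 * c) (α ^ 2) q (c / q) (c / q) (q ^ 2) := by
  set A := (q ^ (2 * n + 1))⁻¹ with hA
  set B := α * α * q ^ (2 * n + 1 + 1) with hB
  set D := α ^ 2 * q ^ 2 with hD
  have hqn : q ^ n ≠ 0 := pow_ne_zero _ hq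
  have hAB : D = A * B * q := by
    rw [hA, hB, hD]
    field_simp
    ring
  have hD1 : ∀ m < 2 * n + 1, 1 - D * (q ^ 2) ^ m ≠ 0 := fun m hm =>
    sub_ne_zero.2 fun h => hα (m + 1) (by omega) (by omega) (by rw [h, hD]; ring)
  have hq2 : ∀ m : ℕ, 1 - q * q ^ m ≠ 0 := fun m => by
    rw [← pow_succ']; exact one_sub_ne_zero_of_pow hq1 _ (by omega)
  have hq3 : ∀ m : ℕ, 1 - q ^ 2 * (q ^ 2) ^ m ≠ 0 := fun m => by
    rw [← pow_succ', ← pow_mul]; exact one_sub_ne_zero_of_pow hq1 _ (by omega)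
  have hsq : ∀ m : ℕ, (q ^ 2) ^ m = (q ^ m) ^ 2 := fun m => by ring
  set ψ := racahBasis q c y with hψ
  have hrhs : y / (1 - c) * qRacah n (y ^ 2 + 2 * c) (α ^ 2) q (c / q) (c / q) (q ^ 2) =
      ∑ k ∈ range (n + 1), hypCoeff (A * q) (B * q) D (q ^ 2) (q ^ 2) k *
        ∑ m ∈ range (2 * n + 1 + 1), quadCoeffOdd q k m * ψ m := by
    unfold qRacah hypCoeff
    rw [mul_sum]
    refine sum_congr rfl fun k hk => ?_
    have hk' : k ≤ n := by simpa [Nat.lt_succ_iff] using hk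
    have e : ∑ m ∈ range (2 * n + 1 + 1), quadCoeffOdd q k m * ψ m =
        ∑ m ∈ range (2 * k + 2), quadCoeffOdd q k m * ψ m := by
      symm
      apply sum_subset (range_subset_range.2 (by omega))
      intro m _ hm
      have : 2 * k + 2 ≤ m := by simpa using hm
      rw [quadCoeffOdd, quadCoeff_eq_zero q (by omega)]
      ring
    rw [e, ← odd_expansion hq hq1 ψ (racahBasis_zero q c y) k
      (fun m hm => hc m (by omega)) (fun m hm => racahBasis_succ (hc m (by omega))),
      -- The prefactor 1/(1 - c) supplies the first factor of (c;q)_{2k+1}; the rest, (cq;q)_{2k},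
      -- splits into the two base-q² denominators.
      even_product q c y hq, qPoch_succ_left, qPoch_two_mul]
    have e1 : ((q ^ 2) ^ n)⁻¹ = A * q := by
      rw [hA]; field_simp; ring
    have e2 : α ^ 2 * q * (q ^ 2) ^ (n + 1) = B * q := by
      rw [hB]; ring
    have e3 : q * (c / q) * q ^ 2 = c * q * q := by field_simp
    have e4 : c / q * q ^ 2 = c * q := by field_simp
    rw [e1, e2, e3, e4]
    simp only [div_eq_mul_inv, mul_inv]
    ring
  rw [hrhs, qRacah_eq_sum_basis hq]
  simp only [mul_sum]
  rw [sum_comm]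
  simp only [← mul_assoc]
  simp only [← sum_mul]
  refine sum_congr rfl fun m hm => ?_
  congr 1
  have hm' : m ≤ 2 * n + 1 := by simpa [Nat.lt_succ_iff] using hm
  refine eq_of_recurrence (f := fun m => (1 - q * q ^ m) * (1 - D * (q ^ m) ^ 2))
    (g := fun m => q * (1 - A * q ^ m) * (1 - B * q ^ m))
    (d := fun m => ∑ k ∈ range (n + 1),
      hypCoeff (A * q) (B * q) D (q ^ 2) (q ^ 2) k * quadCoeffOdd q k m)
    (2 * n + 1) ?_ ?_ ?_ ?_ m hm'
  · rw [sum_eq_single 0]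
    · have h1 := quadCoeffOdd_mul hq1 0 0
      have h2 := quadCoeff_succ_succ hq hq1 0 0
      have h3 := one_sub_sq_ne_zero hq1 0
      rw [quadCoeff_zero_zero] at h2
      simp only [pow_zero] at h1 h2 h3
      rw [hypCoeff_zero, hypCoeff_zero]
      apply mul_left_cancel₀ h3
      linear_combination -h1 - h2
    · intro k _ hk
      rw [quadCoeffOdd, quadCoeff_of_lt q (by omega)]
      ring
    · simp
  · intro m hm
    rw [← hsq]
    exact mul_ne_zero (hq2 m) (hD1 m hm)
  · intro m hm
    have h := hypCoeff_succ (A := A) (B := B) (hD1 m hm) (hq2 m)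
    simp only [hsq] at h ⊢
    linear_combination h
  · intro m hm
    refine sum_recurrence (e := q) hq hq (quadCoeffOdd q) _ m n ?_ ?_ ?_ ?_
    · exact quadCoeffOdd_intertwine_zero hq hq1 hAB m
    · exact fun k => quadCoeffOdd_intertwine hq hq1 hAB k m
    · intro k hk
      have h := hypCoeff_succ (A := A * q) (B := B * q) (hD1 k (by omega)) (hq3 k)
      simp only [hsq] at h ⊢
      linear_combination h
    · rw [hA]
      field_simp
      ring

end

/-! ### Specialisation to `c = q^{-2N-1}`. -/

theorem mainTheorem6 (q : ℝ) (hq0 : 0 < q) (hq1 : q < 1)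
    (N : ℝ) (hN : ∃ m : ℕ, 1 ≤ m ∧ N = (m : ℝ) / 2) (α x : ℂ) :
    (∀ n : ℕ, n ≤ ⌊N + 1 / 2⌋₊ →
      (∀ j : ℕ, 1 ≤ j → j ≤ 2 * n → α ^ 2 * (q : ℂ) ^ (2 * j) ≠ 1) →
      qRacah (2 * n)
          ((q : ℂ) ^ (-x - (N : ℂ) - 1 / 2) - (q : ℂ) ^ (x - (N : ℂ) - 1 / 2))
          α α ((q : ℂ) ^ (-2 * (N : ℂ) - 2)) (-1) (q : ℂ) =
        qRacah n
          ((q : ℂ) ^ (-2 * x - 2 * (N : ℂ) - 1) + (q : ℂ) ^ (2 * x - 2 * (N : ℂ) - 1))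
          (α ^ 2) ((q : ℂ)⁻¹) ((q : ℂ) ^ (-2 * (N : ℂ) - 2)) ((q : ℂ) ^ (-2 * (N : ℂ) - 2))
          ((q : ℂ) ^ 2)) ∧
    (∀ n : ℕ, n ≤ ⌊N⌋₊ →
      (∀ j : ℕ, 1 ≤ j → j ≤ 2 * n + 1 → α ^ 2 * (q : ℂ) ^ (2 * j) ≠ 1) →
      qRacah (2 * n + 1)
          ((q : ℂ) ^ (-x - (N : ℂ) - 1 / 2) - (q : ℂ) ^ (x - (N : ℂ) - 1 / 2))
          α α ((q : ℂ) ^ (-2 * (N : ℂ) - 2)) (-1) (q : ℂ) =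
        ((q : ℂ) ^ (-x - (N : ℂ) - 1 / 2) - (q : ℂ) ^ (x - (N : ℂ) - 1 / 2)) /
            (1 - (q : ℂ) ^ (-2 * (N : ℂ) - 1)) *
          qRacah n
            ((q : ℂ) ^ (-2 * x - 2 * (N : ℂ) - 1) + (q : ℂ) ^ (2 * x - 2 * (N : ℂ) - 1))
            (α ^ 2) (q : ℂ) ((q : ℂ) ^ (-2 * (N : ℂ) - 2)) ((q : ℂ) ^ (-2 * (N : ℂ) - 2))
            ((q : ℂ) ^ 2)) := by
  obtain ⟨M, -, rfl⟩ := hN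
  have hq : (q : ℂ) ≠ 0 := by exact_mod_cast hq0.ne'
  have hq1' : ∀ j : ℕ, 1 ≤ j → (q : ℂ) ^ j ≠ 1 := by
    intro j hj h
    have h' : q ^ j = 1 := by exact_mod_cast h
    exact (pow_lt_one₀ hq0.le hq1 (by omega)).ne h'
  set c : ℂ := ((q : ℂ) ^ (M + 1))⁻¹ with hc
  have hc1 : (q : ℂ) ^ (-2 * (((M : ℝ) / 2 : ℝ) : ℂ) - 1) = c := by
    rw [hc, ← Complex.cpow_natCast, ← Complex.cpow_neg]
    congr 1
    push_cast
    ring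
  have hc2 : (q : ℂ) ^ (-2 * (((M : ℝ) / 2 : ℝ) : ℂ) - 2) = c / q := by
    rw [← hc1, eq_div_iff hq]
    nth_rewrite 2 [← Complex.cpow_one (q : ℂ)]
    rw [← Complex.cpow_add _ _ hq]
    congr 1
    ring
  -- Since M = 2N, the floor bounds on `n` are exactly what keeps the basis denominators within this
  -- range.
  have hcm : ∀ m < M + 1, 1 - c * (q : ℂ) ^ m ≠ 0 := by
    intro m hm h
    have h1 : (q : ℂ) ^ (M + 1) ≠ 0 := pow_ne_zero _ hq
    have h2 : (q : ℂ) ^ (M + 1) = (q : ℂ) ^ m * (q : ℂ) ^ (M + 1 - m) := by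
      rw [← pow_add]; congr 1; omega
    have h3 : (q : ℂ) ^ m = (q : ℂ) ^ (M + 1) := by
      rw [hc, sub_eq_zero] at h
      field_simp at h
      exact h.symm
    rw [← h3] at h2
    exact hq1' (M + 1 - m) (by omega)
      (mul_left_cancel₀ (pow_ne_zero m hq) (by rw [← h2, mul_one]))
  have hy : (q : ℂ) ^ (-2 * x - 2 * (((M : ℝ) / 2 : ℝ) : ℂ) - 1) +
      (q : ℂ) ^ (2 * x - 2 * (((M : ℝ) / 2 : ℝ) : ℂ) - 1) =
      ((q : ℂ) ^ (-x - (((M : ℝ) / 2 : ℝ) : ℂ) - 1 / 2) -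
        (q : ℂ) ^ (x - (((M : ℝ) / 2 : ℝ) : ℂ) - 1 / 2)) ^ 2 + 2 * c := by
    rw [← hc1]
    generalize (((M : ℝ) / 2 : ℝ) : ℂ) = N
    rw [show -2 * x - 2 * N - 1 = (-x - N - 1 / 2) + (-x - N - 1 / 2) by ring,
      show 2 * x - 2 * N - 1 = (x - N - 1 / 2) + (x - N - 1 / 2) by ring,
      show -2 * N - 1 = (-x - N - 1 / 2) + (x - N - 1 / 2) by ring,
      Complex.cpow_add _ _ hq, Complex.cpow_add _ _ hq, Complex.cpow_add _ _ hq]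
    ring
  rw [hc1, hc2, hy]
  constructor
  · intro n hn hα
    have hn' : 2 * n ≤ M + 1 := by
      have h := (Nat.le_floor_iff (by positivity)).1 hn
      have h' : (2 * n : ℝ) ≤ M + 1 := by linarith
      exact_mod_cast h'
    exact qRacah_even hq hq1' n _ α c (fun m hm => hcm m (by omega)) hα
  · intro n hn hα
    have hn' : 2 * n ≤ M := by
      have h := (Nat.le_floor_iff (by positivity)).1 hn
      have h' : (2 * n : ℝ) ≤ M := by linarith
      exact_mod_cast h'
    exact qRacah_odd hq hq1' n _ α c (fun m hm => hcm m (by omega)) hα
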